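/- Let $\mathcal H$ and $\mathcal L$ be (complex) Hilbert spaces, let $\otimes$ denote the Hilbert space tensor product, $\mathcal U(\cdot)$ the group of unitary operators, and $\Sigma$ the flip of tensor factors; use leg numbering notation. A unitary $W\in\mathcal U(\mathcal H\otimes\mathcal H)$ is \emph{multiplicative} if $W_{23}W_{12}=W_{12}W_{13}W_{23}$. Let $(\mathbb W,U,V,\mathbb F)$ with $\mathbb W\in\mathcal U(\mathcal H\otimes\mathcal H)$, $U\in\mathcal U(\mathcal L\otimes\mathcal H)$, $V\in\mathcal U(\mathcal H\otimes\mathcal L)$, $\mathbb F\in\mathcal U(\mathcal L\otimes\mathcal L)$ be a (top-)braided multiplicative unitary, that is: 1. $\mathbb W$ is multiplicative; 2. $U$ is a right representation of $\mathbb W$: $\mathbb W_{23}U_{12}=U_{12}U_{13}\mathbb W_{23}$ on $\mathcal L\otimes\mathcal H\otimes\mathcal H$; 3. $V$ is a left representation of $\mathbb W$: $V_{23}\mathbb W_{12}=\mathbb W_{12}V_{13}V_{23}$ on $\mathcal H\otimes\mathcal H\otimes\mathcal L$; 4. $U$ and $V$ are compatible: $U_{23}\mathbb W_{13}V_{12}=V_{12}\mathbb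 W_{13}U_{23}$ on $\mathcal H\otimes\mathcal L\otimes\mathcal H$; 5. $\mathbb F$ is $U$-invariant: $U_{13}U_{23}\mathbb F_{12}=\mathbb F_{12}U_{13}U_{23}$ on $\mathcal L\otimes\mathcal L\otimes\mathcal H$; 6. $\mathbb F$ is $V$-invariant: $V_{13}V_{12}\mathbb F_{23}=\mathbb F_{23}V_{13}V_{12}$ on $\mathcal H\otimes\mathcal L\otimes\mathcal L$; 7. there is $Z\in\mathcal U(\mathcal L\otimes\mathcal L)$ with $Z_{13}=V_{23}U_{12}^*V_{23}^*U_{12}$ on $\mathcal L\otimes\mathcal H\otimes\mathcal L$ such that, for the braiding $c:=Z\Sigma$, the braided pentagon equation $\mathbb F_{23}\mathbb F_{12}=\mathbb F_{12}c_{23}\mathbb F_{12}c_{23}^*\mathbb F_{23}$ holds on $\mathcal L\otimes\mathcal L\otimes\mathcal L$. For multiplicative unitaries $W^1\in\mathcal U(\mathcal H_1\otimes\mathcal H_1)$ and $W^2\in\mathcal U(\mathcal H_2\otimes\mathcal H_2)$, a \emph{bicharacter} from $W^1$ to $W^2$ is $X\in\mathcal U(\mathcal H_1\otimes\mathcal H_2)$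 with $W^2_{23}X_{12}=X_{12}X_{13}W^2_{23}$ and $X_{23}W^1_{12}=W^1_{12}X_{13}X_{23}$. The \emph{composite} of $X\in\mathcal U(\mathcal H_1\otimes\mathcal H_2)$ and $Y\in\mathcal U(\mathcal H_2\otimes\mathcal H_3)$ is, if it exists, the unique $T\in\mathcal U(\mathcal H_1\otimes\mathcal H_3)$ with $Y_{23}X_{12}=X_{12}T_{13}Y_{23}$. Define $$\mathbb W^C:=\mathbb W_{13}U_{23}V_{34}^*\mathbb F_{24}V_{34}\in\mathcal U(\mathcal H\otimes\mathcal L\otimes\mathcal H\otimes\mathcal L),\qquad \mathbb P:=\mathbb W_{13}U_{23}\in\mathcal U(\mathcal H\otimes\mathcal L\otimes\mathcal H\otimes\mathcal L).$$ Then $\mathbb W^C$ is a multiplicative unitary on the Hilbert space $\mathcal H\otimes\mathcal L$; the operator $\mathbb W_{13}U_{23}\in\mathcal U((\mathcal H\otimes\mathcal L)\otimes\mathcal H)$ is a bicharacter from $\mathbb W^C$ to $\mathbb W$; the operator $\mathbb W_{12}\in\mathcal U(\mathcal H\otimes(\mathcal H\otimes\mathcal L))$ is a bicharacter from $\mathbb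 W$ to $\mathbb W^C$; and their composite from $\mathbb W^C$ to itself exists and is $\mathbb P$. Moreover, $\mathbb P$ is an idempotent bicharacter from $\mathbb W^C$ to itself, that is, the following equations hold on the threefold tensor product of $\mathcal H\otimes\mathcal L$: $$\mathbb P_{23}\mathbb W^C_{12}=\mathbb W^C_{12}\mathbb P_{13}\mathbb P_{23},\qquad \mathbb W^C_{23}\mathbb P_{12}=\mathbb P_{12}\mathbb P_{13}\mathbb W^C_{23},\qquad \mathbb P_{23}\mathbb P_{12}=\mathbb P_{12}\mathbb P_{13}\mathbb P_{23}.$$ -/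

import Mathlib

open scoped TensorProduct

noncomputable section

/-- The Hilbert space tensor product: the completion of the algebraic tensor product for the
inner product `⟪a ⊗ b, c ⊗ d⟫ = ⟪a, c⟫ * ⟪b, d⟫`. -/
def HilbertTensor (A B : Type*) [NormedAddCommGroup A] [InnerProductSpace ℂ A]
    [NormedAddCommGroup B] [InnerProductSpace ℂ B] : Type _ :=
  UniformSpace.Completion (A ⊗[ℂ] B)

infixr:70 "⊗ᴴ" => HilbertTensor

/-- The unitary operators on `E`, as a group under composition; the inverse is the adjoint. -/
abbrev UnitaryOp (E : Type*) [NormedAddCommGroup E] [InnerProductSpace ℂ E] : Type _ :=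
  E ≃ₗᵢ[ℂ] E

namespace HilbertTensor

variable {A B C D : Type*} [NormedAddCommGroup A] [InnerProductSpace ℂ A]
  [NormedAddCommGroup B] [InnerProductSpace ℂ B] [NormedAddCommGroup C] [InnerProductSpace ℂ C]
  [NormedAddCommGroup D] [InnerProductSpace ℂ D]

instance instNormedAddCommGroup : NormedAddCommGroup (A ⊗ᴴ B) :=
  inferInstanceAs (NormedAddCommGroup (UniformSpace.Completion (A ⊗[ℂ] B)))

instance instInnerProductSpace : InnerProductSpace ℂ (A ⊗ᴴ B) :=
  inferInstanceAs (InnerProductSpace ℂ (UniformSpace.Completion (A ⊗[ℂ] B)))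

instance instCompleteSpace : CompleteSpace (A ⊗ᴴ B) :=
  inferInstanceAs (CompleteSpace (UniformSpace.Completion (A ⊗[ℂ] B)))

variable (A B) in
/-- The canonical isometric embedding of the algebraic tensor product. -/
def incl : A ⊗[ℂ] B →ₗᵢ[ℂ] A ⊗ᴴ B :=
  (UniformSpace.Completion.toComplₗᵢ :
    A ⊗[ℂ] B →ₗᵢ[ℂ] UniformSpace.Completion (A ⊗[ℂ] B))

/-- The elementary tensor `a ⊗ b`. -/
def tmul (a : A) (b : B) : A ⊗ᴴ B := incl A B (a ⊗ₜ[ℂ] b)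

theorem denseRange_incl : DenseRange (incl A B) :=
  UniformSpace.Completion.denseRange_coe

/-- Tensoring two linear isometries with dense range gives an isometry with dense range. -/
theorem denseRange_mapIsometry {f : A →ₗᵢ[ℂ] C} {g : B →ₗᵢ[ℂ] D}
    (hf : DenseRange f) (hg : DenseRange g) :
    DenseRange (TensorProduct.mapIsometry f g) := by
  intro z
  have key : (⊤ : Submodule ℂ (C ⊗[ℂ] D)) ≤
      (LinearMap.range (TensorProduct.mapIsometry f g).toLinearMap).topologicalClosure := by
    rw [← TensorProduct.span_tmul_eq_top, Submodule.span_le]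
    rintro _ ⟨c, d, rfl⟩
    have hcont : Continuous fun p : C × D => p.1 ⊗ₜ[ℂ] p.2 := TensorProduct.continuous_tmul
    have hd : (c, d) ∈ closure (Set.range (Prod.map f g)) := (hf.prodMap hg) (c, d)
    have h2 := image_closure_subset_closure_image hcont ⟨(c, d), hd, rfl⟩
    refine closure_mono ?_ h2
    rintro _ ⟨_, ⟨⟨a, b⟩, rfl⟩, rfl⟩
    exact ⟨a ⊗ₜ b, by simp⟩
  exact key (Submodule.mem_top (x := z))

/-- The isometric isomorphism `f ⊗ g`. -/
def map (f : A ≃ₗᵢ[ℂ] C) (g : B ≃ₗᵢ[ℂ] D) : A ⊗ᴴ B ≃ₗᵢ[ℂ] C ⊗ᴴ D :=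
  (TensorProduct.congrIsometry f g).toLinearEquiv.extendOfIsometry
    (incl A B).toLinearMap (incl C D).toLinearMap denseRange_incl denseRange_incl
    fun x => by
      change ‖incl C D (TensorProduct.congrIsometry f g x)‖ = ‖incl A B x‖
      simp only [LinearIsometry.norm_map, LinearIsometryEquiv.norm_map]

variable (A B) in
/-- The flip `Σ`, given by `a ⊗ b ↦ b ⊗ a`. -/
def comm : A ⊗ᴴ B ≃ₗᵢ[ℂ] B ⊗ᴴ A :=
  (TensorProduct.commIsometry ℂ A B).toLinearEquiv.extendOfIsometry
    (incl A B).toLinearMap (incl B A).toLinearMap denseRange_incl denseRange_incl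
    fun x => by
      change ‖incl B A (TensorProduct.commIsometry ℂ A B x)‖ = ‖incl A B x‖
      simp only [LinearIsometry.norm_map, LinearIsometryEquiv.norm_map]

variable (A B C) in
/-- The canonical embedding of `(A ⊗ B) ⊗ C` from the algebraic triple tensor product. -/
def inclL : (A ⊗[ℂ] B) ⊗[ℂ] C →ₗᵢ[ℂ] (A ⊗ᴴ B) ⊗ᴴ C :=
  (incl (A ⊗ᴴ B) C).comp (TensorProduct.mapIsometry (incl A B) LinearIsometry.id)

variable (A B C) in
/-- The canonical embedding of `A ⊗ (B ⊗ C)` from the algebraic triple tensor product. -/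
def inclR : A ⊗[ℂ] (B ⊗[ℂ] C) →ₗᵢ[ℂ] A ⊗ᴴ (B ⊗ᴴ C) :=
  (incl A (B ⊗ᴴ C)).comp (TensorProduct.mapIsometry LinearIsometry.id (incl B C))

theorem denseRange_inclL : DenseRange (inclL A B C) :=
  denseRange_incl.comp (denseRange_mapIsometry denseRange_incl denseRange_id)
    (incl (A ⊗ᴴ B) C).continuous

theorem denseRange_inclR : DenseRange (inclR A B C) :=
  denseRange_incl.comp (denseRange_mapIsometry denseRange_id denseRange_incl)
    (incl A (B ⊗ᴴ C)).continuous

variable (A B C) in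
/-- The associator, given by `(a ⊗ b) ⊗ c ↦ a ⊗ (b ⊗ c)`. -/
def assoc : (A ⊗ᴴ B) ⊗ᴴ C ≃ₗᵢ[ℂ] A ⊗ᴴ (B ⊗ᴴ C) :=
  (TensorProduct.assocIsometry ℂ A B C).toLinearEquiv.extendOfIsometry
    (inclL A B C).toLinearMap (inclR A B C).toLinearMap denseRange_inclL denseRange_inclR
    fun x => by
      change ‖inclR A B C (TensorProduct.assocIsometry ℂ A B C x)‖ = ‖inclL A B C x‖
      simp only [LinearIsometry.norm_map, LinearIsometryEquiv.norm_map]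

theorem map_tmul (f : A ≃ₗᵢ[ℂ] C) (g : B ≃ₗᵢ[ℂ] D) (a : A) (b : B) :
    map f g (tmul a b) = tmul (f a) (g b) :=
  LinearEquiv.extendOfIsometry_eq _ (incl A B).toLinearMap (incl C D).toLinearMap _ _ _
    (a ⊗ₜ[ℂ] b)

theorem comm_tmul (a : A) (b : B) : comm A B (tmul a b) = tmul b a :=
  LinearEquiv.extendOfIsometry_eq _ (incl A B).toLinearMap (incl B A).toLinearMap _ _ _
    (a ⊗ₜ[ℂ] b)

theorem assoc_tmul (a : A) (b : B) (c : C) :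
    assoc A B C (tmul (tmul a b) c) = tmul a (tmul b c) :=
  LinearEquiv.extendOfIsometry_eq _ (inclL A B C).toLinearMap (inclR A B C).toLinearMap _ _ _
    ((a ⊗ₜ[ℂ] b) ⊗ₜ[ℂ] c)

/-- Transport of a unitary operator along an isometric isomorphism: `e T e⁻¹`. -/
def conj (e : A ≃ₗᵢ[ℂ] B) (T : UnitaryOp A) : UnitaryOp B := (e.symm.trans T).trans e

/-- Leg numbering on `A ⊗ (B ⊗ C)`: the operator `T₁₂`. -/
def leg12 (T : UnitaryOp (A ⊗ᴴ B)) : UnitaryOp (A ⊗ᴴ (B ⊗ᴴ C)) :=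
  conj (assoc A B C) (map T (1 : UnitaryOp C))

/-- Leg numbering on `A ⊗ (B ⊗ C)`: the operator `T₂₃ = 1 ⊗ T`. -/
def leg23 (T : UnitaryOp (B ⊗ᴴ C)) : UnitaryOp (A ⊗ᴴ (B ⊗ᴴ C)) :=
  map (1 : UnitaryOp A) T

/-- Leg numbering on `A ⊗ (B ⊗ C)`: the operator `T₁₃ = Σ₂₃ T₁₂ Σ₂₃`. -/
def leg13 (T : UnitaryOp (A ⊗ᴴ C)) : UnitaryOp (A ⊗ᴴ (B ⊗ᴴ C)) :=
  conj (map (1 : UnitaryOp A) (comm C B)) (leg12 T)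

end HilbertTensor

open HilbertTensor

section Definitions

variable {H L K A B C : Type*} [NormedAddCommGroup H] [InnerProductSpace ℂ H]
  [NormedAddCommGroup L] [InnerProductSpace ℂ L] [NormedAddCommGroup K] [InnerProductSpace ℂ K]
  [NormedAddCommGroup A] [InnerProductSpace ℂ A] [NormedAddCommGroup B] [InnerProductSpace ℂ B]
  [NormedAddCommGroup C] [InnerProductSpace ℂ C]

/-- The pentagon equation `W₂₃ W₁₂ = W₁₂ W₁₃ W₂₃` on `H ⊗ H ⊗ H`. -/
def IsMultiplicativeUnitary (W : UnitaryOp (H ⊗ᴴ H)) : Prop :=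
  (leg23 W * leg12 W : UnitaryOp (H ⊗ᴴ (H ⊗ᴴ H))) = leg12 W * leg13 W * leg23 W

/-- `S` is a right representation of `W` on `K`: `W₂₃ S₁₂ = S₁₂ S₁₃ W₂₃` on `K ⊗ H ⊗ H`. -/
def IsRightRep (W : UnitaryOp (H ⊗ᴴ H)) (S : UnitaryOp (K ⊗ᴴ H)) : Prop :=
  (leg23 W * leg12 S : UnitaryOp (K ⊗ᴴ (H ⊗ᴴ H))) = leg12 S * leg13 S * leg23 W

/-- `V` is a left representation of `W` on `K`: `V₂₃ W₁₂ = W₁₂ V₁₃ V₂₃` on `H ⊗ H ⊗ K`. -/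
def IsLeftRep (W : UnitaryOp (H ⊗ᴴ H)) (V : UnitaryOp (H ⊗ᴴ K)) : Prop :=
  (leg23 V * leg12 W : UnitaryOp (H ⊗ᴴ (H ⊗ᴴ K))) = leg12 W * leg13 V * leg23 V

/-- `X` is a bicharacter from `W₁` to `W₂`: it is a right representation of `W₂` on `A` and a
left representation of `W₁` on `B`. -/
def IsBicharacter (W₁ : UnitaryOp (A ⊗ᴴ A)) (W₂ : UnitaryOp (B ⊗ᴴ B))
    (X : UnitaryOp (A ⊗ᴴ B)) : Prop :=
  IsRightRep W₂ X ∧ IsLeftRep W₁ X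

/-- `Z` is the composite of the bicharacters `X` (from `A` to `B`) and `Y` (from `B` to `C`):
the unique unitary with `Y₂₃ X₁₂ = X₁₂ Z₁₃ Y₂₃` on `A ⊗ B ⊗ C`. -/
def IsCompositeBicharacter (X : UnitaryOp (A ⊗ᴴ B)) (Y : UnitaryOp (B ⊗ᴴ C))
    (Z : UnitaryOp (A ⊗ᴴ C)) : Prop :=
  ∀ Z' : UnitaryOp (A ⊗ᴴ C),
    (leg23 Y * leg12 X : UnitaryOp (A ⊗ᴴ (B ⊗ᴴ C))) = leg12 X * leg13 Z' * leg23 Y ↔ Z' = Z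

/-- `Z` is the unitary on `K ⊗ L` from which the braiding `L ⊗ K → K ⊗ L` is built as `Z Σ`:
`Z₁₃ = V₂₃ S₁₂* V₂₃* S₁₂` on `K ⊗ H ⊗ L`. -/
def IsBraidingUnitary (S : UnitaryOp (K ⊗ᴴ H)) (V : UnitaryOp (H ⊗ᴴ L))
    (Z : UnitaryOp (K ⊗ᴴ L)) : Prop :=
  (leg13 Z : UnitaryOp (K ⊗ᴴ (H ⊗ᴴ L))) =
    leg23 V * (leg12 S)⁻¹ * (leg23 V)⁻¹ * leg12 S

/-- `(W, U, V, F)` is a (top-)braided multiplicative unitary: `F` is a braided multiplicative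
unitary on `L` over the multiplicative unitary `W` on `H`, with respect to the right
representation `U` and the left representation `V` of `W` on `L`. -/
structure IsBraidedMultiplicativeUnitary (W : UnitaryOp (H ⊗ᴴ H)) (U : UnitaryOp (L ⊗ᴴ H))
    (V : UnitaryOp (H ⊗ᴴ L)) (F : UnitaryOp (L ⊗ᴴ L)) : Prop where
  multiplicative : IsMultiplicativeUnitary W
  rightRep : IsRightRep W U
  leftRep : IsLeftRep W V
  /-- Drinfeld (Yetter-Drinfeld) compatibility `U₂₃ W₁₃ V₁₂ = V₁₂ W₁₃ U₂₃` on `H ⊗ L ⊗ H`. -/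
  compatible : (leg23 U * leg13 W * leg12 V : UnitaryOp (H ⊗ᴴ (L ⊗ᴴ H))) =
    leg12 V * leg13 W * leg23 U
  /-- `F` is invariant for `U ⊗ U`: `U₁₃ U₂₃ F₁₂ = F₁₂ U₁₃ U₂₃` on `L ⊗ L ⊗ H`. -/
  right_invariant : (leg13 U * leg23 U * leg12 F : UnitaryOp (L ⊗ᴴ (L ⊗ᴴ H))) =
    leg12 F * leg13 U * leg23 U
  /-- `F` is invariant for `V ⊗ V`: `V₁₃ V₁₂ F₂₃ = F₂₃ V₁₃ V₁₂` on `H ⊗ L ⊗ L`. -/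
  left_invariant : (leg13 V * leg12 V * leg23 F : UnitaryOp (H ⊗ᴴ (L ⊗ᴴ L))) =
    leg23 F * leg13 V * leg12 V
  /-- The braiding `c = Z Σ` on `L ⊗ L` is defined, and `F` satisfies the top-braided pentagon
  equation `F₂₃ F₁₂ = F₁₂ c₂₃ F₁₂ c₂₃* F₂₃` on `L ⊗ L ⊗ L`. -/
  braided_pentagon : ∃ Z : UnitaryOp (L ⊗ᴴ L), IsBraidingUnitary U V Z ∧
    (leg23 F * leg12 F : UnitaryOp (L ⊗ᴴ (L ⊗ᴴ L))) =
      leg12 F * leg23 (Z * comm L L) * leg12 F * leg23 (Z * comm L L)⁻¹ * leg23 F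

/-- `W₁₃ U₂₃` on `H ⊗ L ⊗ H`, viewed on `(H ⊗ L) ⊗ H`. -/
def bicharToBase (W : UnitaryOp (H ⊗ᴴ H)) (U : UnitaryOp (L ⊗ᴴ H)) :
    UnitaryOp ((H ⊗ᴴ L) ⊗ᴴ H) :=
  conj (assoc H L H).symm (leg13 W * leg23 U)

/-- `W₁₂` on `H ⊗ (H ⊗ L)`. -/
def bicharFromBase (W : UnitaryOp (H ⊗ᴴ H)) : UnitaryOp (H ⊗ᴴ (H ⊗ᴴ L)) :=
  leg12 W

/-- `P = W₁₃ U₂₃` on `(H ⊗ L) ⊗ (H ⊗ L)`. -/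
def semidirectProjection (W : UnitaryOp (H ⊗ᴴ H)) (U : UnitaryOp (L ⊗ᴴ H)) :
    UnitaryOp ((H ⊗ᴴ L) ⊗ᴴ (H ⊗ᴴ L)) :=
  leg12 (bicharToBase W U)

/-- The semidirect product `W^C = W₁₃ U₂₃ V₃₄* F₂₄ V₃₄` on `(H ⊗ L) ⊗ (H ⊗ L)`. The factor
`V₃₄* F₂₄ V₃₄` is `1 ⊗ (V₂₃* F₁₃ V₂₃)` on `H ⊗ (L ⊗ H ⊗ L)`. -/
def semidirectUnitary (W : UnitaryOp (H ⊗ᴴ H)) (U : UnitaryOp (L ⊗ᴴ H))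
    (V : UnitaryOp (H ⊗ᴴ L)) (F : UnitaryOp (L ⊗ᴴ L)) :
    UnitaryOp ((H ⊗ᴴ L) ⊗ᴴ (H ⊗ᴴ L)) :=
  semidirectProjection W U *
    conj (assoc H L (H ⊗ᴴ L)).symm
      (map (1 : UnitaryOp H)
        ((leg23 V)⁻¹ * leg13 F * leg23 V : UnitaryOp (L ⊗ᴴ (H ⊗ᴴ L))))

end Definitions

end

open HilbertTensor

/-!
Write `W^C = P Q` with `P = W₁₃ U₂₃` and `Q = V₃₄* F₂₄ V₃₄`. Both bicharacter conditions, the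
composition of bicharacters and the pentagon equation have the shape `Y₂₃ X₁₂ = X₁₂ Z₁₃ Y₂₃`, which
is stable under tensoring representations and under adding legs. This settles everything that
involves only `W` and `U`. The invariance of `F` under `U`, together with the compatibility of `U`
and `V`, says that `Q` commutes with the tensor square of `W₁₃ U₂₃`, so that `W₁₃ U₂₃` is also a
left representation of `W^C`.

The pentagon equation for `W^C` then reduces to `Q₂₃ Q₁₂ = Q₁₂ (P₂₃* Q₁₃ P₂₃) Q₂₃`. On the legs
`L ⊗ H ⊗ L ⊗ H ⊗ L`, conjugation by `V₂₅ V₂₃ V₄₅` takes `Q₁₂` to `F₁₃`, `Q₂₃` to `F₃₅` and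
`P₂₃* Q₁₃ P₂₃` to `Z₃₅ F₁₅ Z₃₅*`, which turns this into the braided pentagon equation. The second
of these uses the invariance of `F` under `V`. The third uses `V₁₃ V₁₂ Z₂₃ = Z₂₃ V₁₂ V₁₃`, which
holds since `V` is a left representation compatible with `U`.
-/

namespace HilbertTensor

variable {A B C D E X Y : Type*} [NormedAddCommGroup A] [InnerProductSpace ℂ A]
  [NormedAddCommGroup B] [InnerProductSpace ℂ B] [NormedAddCommGroup C] [InnerProductSpace ℂ C]
  [NormedAddCommGroup D] [InnerProductSpace ℂ D] [NormedAddCommGroup E] [InnerProductSpace ℂ E]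
  [NormedAddCommGroup X] [InnerProductSpace ℂ X] [NormedAddCommGroup Y] [InnerProductSpace ℂ Y]

theorem norm_tmul (a : A) (b : B) : ‖tmul a b‖ = ‖a‖ * ‖b‖ := by
  rw [tmul, LinearIsometry.norm_map, TensorProduct.norm_tmul]

variable (A B) in
/-- The elementary tensor `a ⊗ b` as a continuous bilinear map. Extensionality is stated through
it, so that `ext` descends into nested tensor products, however they are bracketed. -/
noncomputable def tmulL : A →L[ℂ] B →L[ℂ] A ⊗ᴴ B :=
  LinearMap.mkContinuous₂ ((TensorProduct.mk ℂ A B).compr₂ (incl A B).toLinearMap) 1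
    fun a b => by rw [one_mul]; exact (norm_tmul a b).le

@[simp] theorem tmulL_apply (a : A) (b : B) : tmulL A B a b = tmul a b := rfl

@[ext] theorem continuousLinearMap_ext {G : Type*} [NormedAddCommGroup G] [NormedSpace ℂ G]
    {f g : A ⊗ᴴ B →L[ℂ] G}
    (h : ContinuousLinearMap.compL ℂ B (A ⊗ᴴ B) G f ∘L tmulL A B =
      ContinuousLinearMap.compL ℂ B (A ⊗ᴴ B) G g ∘L tmulL A B) : f = g := by
  refine ContinuousLinearMap.coeFn_injective
    (denseRange_incl.equalizer f.continuous g.continuous (funext fun x => ?_))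
  induction x using TensorProduct.induction_on with
  | zero => simp
  | tmul a b => exact DFunLike.congr_fun (DFunLike.congr_fun h a) b
  | add x y hx hy =>
    simp only [Function.comp_apply, map_add] at hx hy ⊢
    rw [hx, hy]

@[ext] theorem linearIsometryEquiv_ext {f g : A ⊗ᴴ B ≃ₗᵢ[ℂ] C}
    (h : (f.toContinuousLinearEquiv : A ⊗ᴴ B →L[ℂ] C) = g.toContinuousLinearEquiv) : f = g :=
  LinearIsometryEquiv.ext fun x => DFunLike.congr_fun h x

instance [Subsingleton A] : Subsingleton (A ⊗ᴴ B) :=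
  subsingleton_of_forall_eq 0 fun x =>
    have : ContinuousLinearMap.id ℂ (A ⊗ᴴ B) = 0 := by
      ext a
      simp [Subsingleton.elim a 0]
    DFunLike.congr_fun this x

attribute [simp] map_tmul comm_tmul assoc_tmul

@[simp] theorem assoc_symm_tmul (a : A) (b : B) (c : C) :
    (assoc A B C).symm (tmul a (tmul b c)) = tmul (tmul a b) c := by
  rw [LinearIsometryEquiv.symm_apply_eq, assoc_tmul]

/-- `conj` as an isomorphism of unitary groups. -/
noncomputable def conjMulEquiv (e : A ≃ₗᵢ[ℂ] B) : UnitaryOp A ≃* UnitaryOp B where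
  toFun := conj e
  invFun := conj e.symm
  left_inv T := by ext x; simp [conj]
  right_inv T := by ext x; simp [conj]
  map_mul' S T := by ext x; simp [conj]

theorem conj_mul (e : A ≃ₗᵢ[ℂ] B) (S T : UnitaryOp A) : conj e (S * T) = conj e S * conj e T :=
  map_mul (conjMulEquiv e) S T

theorem conj_inv (e : A ≃ₗᵢ[ℂ] B) (T : UnitaryOp A) : conj e T⁻¹ = (conj e T)⁻¹ :=
  map_inv (conjMulEquiv e) T

theorem conj_injective (e : A ≃ₗᵢ[ℂ] B) : Function.Injective (conj e) :=
  (conjMulEquiv e).injective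

theorem conj_conj_symm (e : A ≃ₗᵢ[ℂ] B) (T : UnitaryOp B) : conj e (conj e.symm T) = T :=
  (conjMulEquiv e).apply_symm_apply T

theorem conj_eq_of_trans_eq {e : A ≃ₗᵢ[ℂ] B} {T : UnitaryOp A} {S : UnitaryOp B}
    (h : T.trans e = e.trans S) : conj e T = S := by
  ext x
  simpa [conj] using DFunLike.congr_fun h (e.symm x)

/-- The operator `T ⊗ 1` transported along `e : A ⊗ X ≃ E`. Every leg embedding is of this form,
so identities between iterated leg embeddings amount to identities between the maps `e`. -/
noncomputable def amplify (e : A ⊗ᴴ X ≃ₗᵢ[ℂ] E) : UnitaryOp A →* UnitaryOp E :=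
  MonoidHom.mk' (fun T => conj e (map T 1)) fun S T => by
    rw [← conj_mul]
    congr 1
    ext a x
    simp

theorem amplify_apply (e : A ⊗ᴴ X ≃ₗᵢ[ℂ] E) (T : UnitaryOp A) :
    amplify e T = conj e (map T 1) := rfl

theorem conj_amplify (e : A ⊗ᴴ X ≃ₗᵢ[ℂ] D) (f : D ≃ₗᵢ[ℂ] E) (T : UnitaryOp A) :
    conj f (amplify e T) = amplify (e.trans f) T := rfl

theorem amplify_conj (e : B ⊗ᴴ X ≃ₗᵢ[ℂ] E) (f : A ≃ₗᵢ[ℂ] B) (T : UnitaryOp A) :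
    amplify e (conj f T) = amplify ((map f (1 : UnitaryOp X)).trans e) T := by
  refine (conj_eq_of_trans_eq ?_).symm
  ext a x
  simp [amplify_apply, conj]

theorem amplify_amplify (e : D ⊗ᴴ Y ≃ₗᵢ[ℂ] E) (f : A ⊗ᴴ X ≃ₗᵢ[ℂ] D) (T : UnitaryOp A) :
    amplify e (amplify f T) = amplify ((assoc A X Y).symm.trans ((map f 1).trans e)) T := by
  refine (conj_eq_of_trans_eq ?_).symm
  ext a x y
  simp [amplify_apply, conj]

theorem amplify_congr {e : A ⊗ᴴ X ≃ₗᵢ[ℂ] E} {f : A ⊗ᴴ Y ≃ₗᵢ[ℂ] E} (g : X ≃ₗᵢ[ℂ] Y)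
    (h : e = (map 1 g).trans f) (T : UnitaryOp A) : amplify e T = amplify f T := by
  subst h
  refine conj_eq_of_trans_eq ?_
  ext a x
  simp [amplify_apply, conj]

theorem commute_amplify {e : A ⊗ᴴ X ≃ₗᵢ[ℂ] E} {f : B ⊗ᴴ Y ≃ₗᵢ[ℂ] E} (i : X ≃ₗᵢ[ℂ] B)
    (j : A ≃ₗᵢ[ℂ] Y) (h : e = (map 1 i).trans ((comm A B).trans ((map 1 j).trans f)))
    (S : UnitaryOp A) (T : UnitaryOp B) : Commute (amplify e S) (amplify f T) := by
  let k : A ⊗ᴴ B ≃ₗᵢ[ℂ] E := (comm A B).trans ((map 1 j).trans f)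
  have hT : conj k (map 1 T) = amplify f T := by
    refine conj_eq_of_trans_eq ?_
    ext a b
    simp [k, amplify_apply, conj]
  rw [amplify_congr i h, ← hT, amplify_apply]
  refine Commute.map (f := conjMulEquiv k) ?_
  ext a b
  simp

theorem amplify_injective [Nontrivial X] (e : A ⊗ᴴ X ≃ₗᵢ[ℂ] E) :
    Function.Injective (amplify e) := by
  intro S T h
  obtain ⟨x, hx⟩ := exists_ne (0 : X)
  refine LinearIsometryEquiv.ext fun a => sub_eq_zero.1 (norm_eq_zero.1 ?_)
  have hST : tmul (S a) x = tmul (T a) x := by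
    simpa using DFunLike.congr_fun (conj_injective e h) (tmul a x)
  have hsub : tmul (S a - T a) x = 0 := by
    rw [← tmulL_apply, map_sub, sub_apply, tmulL_apply, tmulL_apply, hST, sub_self]
  rw [← norm_eq_zero, norm_tmul] at hsub
  exact (mul_eq_zero.1 hsub).resolve_right (norm_ne_zero_iff.2 hx)

variable (A B C D) in
/-- The isomorphism `(a ⊗ (b ⊗ c)) ⊗ d ↦ a ⊗ (b ⊗ (c ⊗ d))`, used to place a fourth leg. -/
noncomputable def assoc₄ : (A ⊗ᴴ (B ⊗ᴴ C)) ⊗ᴴ D ≃ₗᵢ[ℂ] A ⊗ᴴ (B ⊗ᴴ (C ⊗ᴴ D)) :=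
  (assoc A (B ⊗ᴴ C) D).trans (map 1 (assoc B C D))

/-- Leg numbering on `A ⊗ (B ⊗ (C ⊗ D))`: `T ↦ T₁₂₃`. -/
noncomputable def leg123 : UnitaryOp (A ⊗ᴴ (B ⊗ᴴ C)) →* UnitaryOp (A ⊗ᴴ (B ⊗ᴴ (C ⊗ᴴ D))) :=
  amplify (assoc₄ A B C D)

/-- Leg numbering on `A ⊗ (B ⊗ (C ⊗ D))`: `T ↦ T₁₂₄`. The two remaining face maps are `leg13`,
which is `T ↦ T₁₃₄`, and `leg23`, which is `T ↦ T₂₃₄`. -/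
noncomputable def leg124 : UnitaryOp (A ⊗ᴴ (B ⊗ᴴ D)) →* UnitaryOp (A ⊗ᴴ (B ⊗ᴴ (C ⊗ᴴ D))) :=
  amplify ((assoc₄ A B D C).trans (map 1 (map 1 (comm D C))))

theorem leg12_eq_amplify (T : UnitaryOp (A ⊗ᴴ B)) :
    (leg12 T : UnitaryOp (A ⊗ᴴ (B ⊗ᴴ C))) = amplify (assoc A B C) T := rfl

theorem leg13_eq_amplify (T : UnitaryOp (A ⊗ᴴ C)) :
    (leg13 T : UnitaryOp (A ⊗ᴴ (B ⊗ᴴ C))) =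
      amplify ((assoc A C B).trans (map 1 (comm C B))) T := rfl

theorem leg23_eq_amplify (T : UnitaryOp (B ⊗ᴴ C)) :
    (leg23 T : UnitaryOp (A ⊗ᴴ (B ⊗ᴴ C))) = amplify (comm (B ⊗ᴴ C) A) T := by
  refine (conj_eq_of_trans_eq ?_).symm
  ext b c a
  simp [leg23]

@[simp] theorem leg12_mul (S T : UnitaryOp (A ⊗ᴴ B)) :
    (leg12 (S * T) : UnitaryOp (A ⊗ᴴ (B ⊗ᴴ C))) = leg12 S * leg12 T :=
  map_mul (amplify (assoc A B C)) S T

@[simp] theorem leg13_mul (S T : UnitaryOp (A ⊗ᴴ C)) :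
    (leg13 (S * T) : UnitaryOp (A ⊗ᴴ (B ⊗ᴴ C))) = leg13 S * leg13 T :=
  map_mul (amplify ((assoc A C B).trans (map 1 (comm C B)))) S T

@[simp] theorem leg23_mul (S T : UnitaryOp (B ⊗ᴴ C)) :
    (leg23 (S * T) : UnitaryOp (A ⊗ᴴ (B ⊗ᴴ C))) = leg23 S * leg23 T := by
  simp only [leg23_eq_amplify, map_mul]

@[simp] theorem leg13_one : leg13 (1 : UnitaryOp (A ⊗ᴴ C)) = (1 : UnitaryOp (A ⊗ᴴ (B ⊗ᴴ C))) :=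
  map_one (amplify ((assoc A C B).trans (map 1 (comm C B))))

@[simp] theorem leg13_inv (T : UnitaryOp (A ⊗ᴴ C)) :
    (leg13 T⁻¹ : UnitaryOp (A ⊗ᴴ (B ⊗ᴴ C))) = (leg13 T)⁻¹ :=
  map_inv (amplify ((assoc A C B).trans (map 1 (comm C B)))) T

@[simp] theorem leg23_inv (T : UnitaryOp (B ⊗ᴴ C)) :
    (leg23 T⁻¹ : UnitaryOp (A ⊗ᴴ (B ⊗ᴴ C))) = (leg23 T)⁻¹ := by
  simp only [leg23_eq_amplify, map_inv]

@[simp] theorem leg13_leg23 (T : UnitaryOp (C ⊗ᴴ D)) :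
    (leg13 (leg23 T) : UnitaryOp (A ⊗ᴴ (B ⊗ᴴ (C ⊗ᴴ D)))) = leg23 (leg23 T) := by
  simp only [leg13_eq_amplify, leg23_eq_amplify, amplify_amplify]
  refine amplify_congr (comm A B) ?_ T
  ext c d a b
  simp

@[simp] theorem leg123_leg12 (T : UnitaryOp (A ⊗ᴴ B)) :
    (leg123 (leg12 T) : UnitaryOp (A ⊗ᴴ (B ⊗ᴴ (C ⊗ᴴ D)))) = leg12 T := by
  simp only [leg123, leg12_eq_amplify, amplify_amplify]
  refine amplify_congr 1 ?_ T
  ext a b c d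
  simp [assoc₄]

@[simp] theorem leg123_leg13 (T : UnitaryOp (A ⊗ᴴ C)) :
    (leg123 (leg13 T) : UnitaryOp (A ⊗ᴴ (B ⊗ᴴ (C ⊗ᴴ D)))) = leg13 (leg12 T) := by
  simp only [leg123, leg12_eq_amplify, leg13_eq_amplify, amplify_amplify]
  refine amplify_congr (comm B D) ?_ T
  ext a c b d
  simp [assoc₄]

@[simp] theorem leg123_leg23 (T : UnitaryOp (B ⊗ᴴ C)) :
    (leg123 (leg23 T) : UnitaryOp (A ⊗ᴴ (B ⊗ᴴ (C ⊗ᴴ D)))) = leg23 (leg12 T) := by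
  simp only [leg123, leg12_eq_amplify, leg23_eq_amplify, amplify_amplify]
  refine amplify_congr (comm A D) ?_ T
  ext b c a d
  simp [assoc₄]

@[simp] theorem leg124_leg12 (T : UnitaryOp (A ⊗ᴴ B)) :
    (leg124 (leg12 T) : UnitaryOp (A ⊗ᴴ (B ⊗ᴴ (C ⊗ᴴ D)))) = leg12 T := by
  simp only [leg124, leg12_eq_amplify, amplify_amplify]
  refine amplify_congr (comm D C) ?_ T
  ext a b d c
  simp [assoc₄]

@[simp] theorem leg124_leg13 (T : UnitaryOp (A ⊗ᴴ D)) :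
    (leg124 (leg13 T) : UnitaryOp (A ⊗ᴴ (B ⊗ᴴ (C ⊗ᴴ D)))) = leg13 (leg13 T) := by
  simp only [leg124, leg13_eq_amplify, amplify_amplify]
  refine amplify_congr (comm B C) ?_ T
  ext a d b c
  simp [assoc₄]

@[simp] theorem leg124_leg23 (T : UnitaryOp (B ⊗ᴴ D)) :
    (leg124 (leg23 T) : UnitaryOp (A ⊗ᴴ (B ⊗ᴴ (C ⊗ᴴ D)))) = leg23 (leg13 T) := by
  simp only [leg124, leg13_eq_amplify, leg23_eq_amplify, amplify_amplify]
  refine amplify_congr (comm A C) ?_ T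
  ext b d a c
  simp [assoc₄]

theorem leg124_injective [Nontrivial C] : Function.Injective
    (leg124 : UnitaryOp (A ⊗ᴴ (B ⊗ᴴ D)) →* UnitaryOp (A ⊗ᴴ (B ⊗ᴴ (C ⊗ᴴ D)))) :=
  amplify_injective _

theorem leg13_injective [Nontrivial B] :
    Function.Injective (leg13 : UnitaryOp (A ⊗ᴴ C) → UnitaryOp (A ⊗ᴴ (B ⊗ᴴ C))) :=
  amplify_injective ((assoc A C B).trans (map 1 (comm C B)))

theorem commute_leg12_leg34 (S : UnitaryOp (A ⊗ᴴ B)) (T : UnitaryOp (C ⊗ᴴ D)) :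
    Commute (leg12 S : UnitaryOp (A ⊗ᴴ (B ⊗ᴴ (C ⊗ᴴ D)))) (leg23 (leg23 T)) := by
  simp only [leg12_eq_amplify, leg23_eq_amplify, amplify_amplify]
  refine commute_amplify 1 (comm A B) ?_ S T
  ext a b c d
  simp

theorem commute_leg13_leg24 (S : UnitaryOp (A ⊗ᴴ C)) (T : UnitaryOp (B ⊗ᴴ D)) :
    Commute (leg13 (leg12 S) : UnitaryOp (A ⊗ᴴ (B ⊗ᴴ (C ⊗ᴴ D)))) (leg23 (leg13 T)) := by
  simp only [leg12_eq_amplify, leg13_eq_amplify, leg23_eq_amplify, amplify_amplify]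
  refine commute_amplify (comm D B) (comm A C) ?_ S T
  ext a c d b
  simp

theorem commute_leg14_leg23 (S : UnitaryOp (A ⊗ᴴ D)) (T : UnitaryOp (B ⊗ᴴ C)) :
    Commute (leg13 (leg13 S) : UnitaryOp (A ⊗ᴴ (B ⊗ᴴ (C ⊗ᴴ D)))) (leg23 (leg12 T)) := by
  simp only [leg12_eq_amplify, leg13_eq_amplify, leg23_eq_amplify, amplify_amplify]
  refine commute_amplify (comm C B) (comm A D) ?_ S T
  ext a d c b
  simp

theorem conj_assoc_leg12 (T : UnitaryOp ((A ⊗ᴴ B) ⊗ᴴ C)) :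
    conj (assoc A B (C ⊗ᴴ D)) (leg12 T) = leg123 (conj (assoc A B C) T) := by
  simp only [leg123, leg12_eq_amplify, amplify_conj, conj_amplify]
  refine amplify_congr 1 ?_ T
  ext a b c d
  simp [assoc₄]

theorem conj_assoc_leg13 (T : UnitaryOp ((A ⊗ᴴ B) ⊗ᴴ D)) :
    conj (assoc A B (C ⊗ᴴ D)) (leg13 T) = leg124 (conj (assoc A B D) T) := by
  simp only [leg124, leg13_eq_amplify, amplify_conj, conj_amplify]
  refine amplify_congr 1 ?_ T
  ext a b d c
  simp [assoc₄]

theorem conj_assoc_leg23 (T : UnitaryOp (C ⊗ᴴ D)) :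
    conj (assoc A B (C ⊗ᴴ D)) (leg23 T) = leg23 (leg23 T) := by
  simp only [leg23_eq_amplify, conj_amplify, amplify_amplify]
  refine amplify_congr (comm A B) ?_ T
  ext c d a b
  simp

theorem conj_map_assoc_leg12 (T : UnitaryOp (A ⊗ᴴ (B ⊗ᴴ C))) :
    conj (map (1 : UnitaryOp A) (assoc B C D)) (leg12 T) = leg123 T := rfl

theorem conj_map_assoc_leg13 (T : UnitaryOp (A ⊗ᴴ D)) :
    conj (map (1 : UnitaryOp A) (assoc B C D)) (leg13 T) = leg13 (leg13 T) := by
  simp only [leg13_eq_amplify, conj_amplify, amplify_amplify]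
  refine amplify_congr (comm B C) ?_ T
  ext a d b c
  simp

theorem conj_map_leg23 (e : A ⊗ᴴ B ≃ₗᵢ[ℂ] C ⊗ᴴ D) (T : UnitaryOp (A ⊗ᴴ B)) :
    conj (map (1 : UnitaryOp E) e) (leg23 T) = leg23 (conj e T) := by
  simp only [leg23_eq_amplify, conj_amplify, amplify_conj]
  refine amplify_congr 1 ?_ T
  ext a b x
  simp

theorem conj_map_map_leg13 (e : C ≃ₗᵢ[ℂ] D) (T : UnitaryOp (A ⊗ᴴ C)) :
    conj (map (1 : UnitaryOp A) (map (1 : UnitaryOp B) e)) (leg13 T) =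
      leg13 (conj (map (1 : UnitaryOp A) e) T) := by
  simp only [leg13_eq_amplify, conj_amplify, amplify_conj]
  refine amplify_congr 1 ?_ T
  ext a c b
  simp

section Group

variable {G : Type*} [Group G]

theorem pentagon_of_semiconjBy {x a b c a' b' c' : G} (ha : SemiconjBy x a a')
    (hb : SemiconjBy x b b') (hc : SemiconjBy x c c') (h : b' * a' = a' * c' * b') :
    b * a = a * c * b := by
  refine mul_left_cancel (a := x) ?_
  rw [(hb.mul_right ha).eq, h, ((ha.mul_right hc).mul_right hb).eq]

theorem pentagon_mul {p₁₂ p₁₃ p₂₃ q₁₂ q₁₃ q₂₃ : G}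
    (hp : p₂₃ * (p₁₂ * q₁₂) = p₁₂ * q₁₂ * p₁₃ * p₂₃)
    (hq : q₂₃ * q₁₂ = q₁₂ * (p₂₃⁻¹ * q₁₃ * p₂₃) * q₂₃) (hqp : Commute q₂₃ p₁₂) :
    p₂₃ * q₂₃ * (p₁₂ * q₁₂) = p₁₂ * q₁₂ * (p₁₃ * q₁₃) * (p₂₃ * q₂₃) :=
  calc p₂₃ * q₂₃ * (p₁₂ * q₁₂)
      = p₂₃ * (q₂₃ * p₁₂) * q₁₂ := by group
    _ = p₂₃ * p₁₂ * (q₂₃ * q₁₂) := by rw [hqp.eq]; group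
    _ = p₂₃ * (p₁₂ * q₁₂) * p₂₃⁻¹ * q₁₃ * p₂₃ * q₂₃ := by rw [hq]; group
    _ = p₁₂ * q₁₂ * (p₁₃ * q₁₃) * (p₂₃ * q₂₃) := by rw [hp]; group

end Group

theorem leg13_commute {S T : UnitaryOp (A ⊗ᴴ C)} (h : Commute S T) :
    Commute (leg13 S : UnitaryOp (A ⊗ᴴ (B ⊗ᴴ C))) (leg13 T) := by
  simpa [Commute, SemiconjBy] using congrArg (leg13 (B := B)) h.eq

theorem leg23_commute {S T : UnitaryOp (B ⊗ᴴ C)} (h : Commute S T) :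
    Commute (leg23 S : UnitaryOp (A ⊗ᴴ (B ⊗ᴴ C))) (leg23 T) := by
  simpa [Commute, SemiconjBy] using congrArg (leg23 (A := A)) h.eq

/-- `Y₂₃ X₁₂ = X₁₂ Z₁₃ Y₂₃`. This is the pentagon equation if `X = Y = Z`, the condition on a
right representation of `Y` if `Z = X`, and on a left representation of `X` if `Z = Y`. -/
def ComposesTo (X : UnitaryOp (A ⊗ᴴ B)) (Y : UnitaryOp (B ⊗ᴴ C)) (Z : UnitaryOp (A ⊗ᴴ C)) :
    Prop :=
  (leg23 Y * leg12 X : UnitaryOp (A ⊗ᴴ (B ⊗ᴴ C))) = leg12 X * leg13 Z * leg23 Y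

/-- `X₁₃ Y₂₃` on `(A ⊗ B) ⊗ C`; for right representations `X` and `Y` of the same multiplicative
unitary this is their tensor product. -/
noncomputable def tensorRep (X : UnitaryOp (A ⊗ᴴ C)) (Y : UnitaryOp (B ⊗ᴴ C)) :
    UnitaryOp ((A ⊗ᴴ B) ⊗ᴴ C) :=
  conj (assoc A B C).symm (leg13 X * leg23 Y)

theorem conj_assoc_tensorRep (X : UnitaryOp (A ⊗ᴴ C)) (Y : UnitaryOp (B ⊗ᴴ C)) :
    conj (assoc A B C) (tensorRep X Y) = leg13 X * leg23 Y :=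
  conj_conj_symm _ _

theorem tensorRep_mul_right (X : UnitaryOp (A ⊗ᴴ C)) (Y R : UnitaryOp (B ⊗ᴴ C)) :
    tensorRep X (Y * R) = tensorRep X Y * tensorRep 1 R := by
  simp only [tensorRep, ← conj_mul, leg23_mul, leg13_one, one_mul, mul_assoc]

theorem leg12_tensorRep (X : UnitaryOp (A ⊗ᴴ C)) (Y : UnitaryOp (B ⊗ᴴ C)) :
    (leg12 (tensorRep X Y) : UnitaryOp ((A ⊗ᴴ B) ⊗ᴴ (C ⊗ᴴ D))) =
      tensorRep (leg12 X) (leg12 Y) := by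
  apply conj_injective (assoc A B (C ⊗ᴴ D))
  simp only [conj_assoc_leg12, conj_assoc_tensorRep, map_mul, leg123_leg13, leg123_leg23]

theorem commute_leg23_tensorRep_one (X : UnitaryOp (A ⊗ᴴ B)) (R : UnitaryOp (D ⊗ᴴ C)) :
    Commute (leg23 (tensorRep (1 : UnitaryOp (B ⊗ᴴ C)) R)) (leg12 (leg12 X)) := by
  apply conj_injective (map (1 : UnitaryOp A) (assoc B D C))
  simp only [conj_mul, conj_map_leg23, conj_assoc_tensorRep, leg13_one, one_mul,
    conj_map_assoc_leg12, leg123_leg12]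
  exact (commute_leg12_leg34 X R).symm.eq

namespace ComposesTo

theorem leg12_right {X : UnitaryOp (A ⊗ᴴ B)} {Y : UnitaryOp (B ⊗ᴴ C)} {Z : UnitaryOp (A ⊗ᴴ C)}
    (h : ComposesTo X Y Z) :
    ComposesTo X (leg12 Y : UnitaryOp (B ⊗ᴴ (C ⊗ᴴ D))) (leg12 Z) := by
  simpa [ComposesTo] using congrArg (leg123 (D := D)) h

theorem isComposite [Nontrivial B] {X : UnitaryOp (A ⊗ᴴ B)} {Y : UnitaryOp (B ⊗ᴴ C)}
    {Z : UnitaryOp (A ⊗ᴴ C)} (h : ComposesTo X Y Z) : IsCompositeBicharacter X Y Z := by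
  refine fun Z' => ⟨fun h' => leg13_injective (B := B) ?_, fun h' => h' ▸ h⟩
  exact mul_left_cancel (mul_right_cancel (h'.symm.trans h))

theorem tensorRep_left {X : UnitaryOp (A ⊗ᴴ B)} {X' : UnitaryOp (D ⊗ᴴ B)} {Y : UnitaryOp (B ⊗ᴴ C)}
    {Z : UnitaryOp (A ⊗ᴴ C)} {Z' : UnitaryOp (D ⊗ᴴ C)} (h : ComposesTo X Y Z)
    (h' : ComposesTo X' Y Z') : ComposesTo (tensorRep X X') Y (tensorRep Z Z') := by
  apply conj_injective (assoc A D (B ⊗ᴴ C))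
  simp only [conj_mul, conj_assoc_leg12, conj_assoc_leg13, conj_assoc_leg23, conj_assoc_tensorRep,
    map_mul, leg123_leg13, leg123_leg23, leg124_leg13, leg124_leg23]
  have hX := congrArg (leg13 (B := D)) h
  have hX' := congrArg (leg23 (A := A)) h'
  simp only [leg13_mul, leg23_mul, leg13_leg23] at hX hX'
  have hZX' := commute_leg14_leg23 Z X'
  rw [← mul_assoc, hX, mul_assoc _ _ (leg23 (leg12 X')), hX']
  simp only [mul_assoc]
  rw [← mul_assoc (leg13 (leg13 Z)), hZX'.eq]
  simp only [mul_assoc]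

theorem leg12_tensorRep {X : UnitaryOp (A ⊗ᴴ B)} {Y : UnitaryOp (B ⊗ᴴ C)} {Z : UnitaryOp (A ⊗ᴴ C)}
    (h : ComposesTo X Y Z) (R : UnitaryOp (D ⊗ᴴ C)) :
    ComposesTo (leg12 X) (tensorRep Y R) Z := by
  apply conj_injective (map (1 : UnitaryOp A) (assoc B D C))
  simp only [conj_mul, conj_map_leg23, conj_assoc_tensorRep, leg23_mul, conj_map_assoc_leg12,
    conj_map_assoc_leg13, leg123_leg12]
  have hY := congrArg (leg124 (C := D)) h
  simp only [map_mul, leg124_leg12, leg124_leg13, leg124_leg23] at hY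
  rw [mul_assoc, ← (commute_leg12_leg34 X R).eq, ← mul_assoc, hY, mul_assoc]

end ComposesTo

/-- The isomorphism `(a ⊗ b) ⊗ ((c ⊗ d) ⊗ e) ↦ a ⊗ (b ⊗ (c ⊗ (d ⊗ e)))`. -/
noncomputable def rebracket :
    (A ⊗ᴴ B) ⊗ᴴ ((C ⊗ᴴ D) ⊗ᴴ E) ≃ₗᵢ[ℂ] A ⊗ᴴ (B ⊗ᴴ (C ⊗ᴴ (D ⊗ᴴ E))) :=
  (assoc A B ((C ⊗ᴴ D) ⊗ᴴ E)).trans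
    (map (1 : UnitaryOp A) (map (1 : UnitaryOp B) (assoc C D E)))

theorem conj_rebracket (T : UnitaryOp ((A ⊗ᴴ B) ⊗ᴴ ((C ⊗ᴴ D) ⊗ᴴ E))) :
    conj rebracket T = conj (map 1 (map 1 (assoc C D E))) (conj (assoc A B _) T) := rfl

theorem conj_rebracket_leg12_tensorRep (X : UnitaryOp (A ⊗ᴴ (C ⊗ᴴ D)))
    (Y : UnitaryOp (B ⊗ᴴ (C ⊗ᴴ D))) :
    conj (rebracket (E := E)) (leg12 (tensorRep X Y)) =
      leg13 (leg123 X) * leg23 (leg123 Y) := by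
  simp only [conj_rebracket, conj_assoc_leg12, conj_assoc_tensorRep, map_mul, conj_mul,
    leg123_leg13, leg123_leg23, conj_map_leg23, conj_map_map_leg13, conj_map_assoc_leg12]

theorem conj_rebracket_leg13_tensorRep (X : UnitaryOp (A ⊗ᴴ E)) (Y : UnitaryOp (B ⊗ᴴ E)) :
    conj (rebracket (C := C) (D := D)) (leg13 (tensorRep X Y)) =
      leg13 (leg13 (leg13 X)) * leg23 (leg13 (leg13 Y)) := by
  simp only [conj_rebracket, conj_assoc_leg13, conj_assoc_tensorRep, map_mul, conj_mul,
    leg124_leg13, leg124_leg23, conj_map_leg23, conj_map_map_leg13, conj_map_assoc_leg13]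

theorem conj_rebracket_leg23_tensorRep (X : UnitaryOp (C ⊗ᴴ E)) (Y : UnitaryOp (D ⊗ᴴ E)) :
    conj (rebracket (A := A) (B := B)) (leg23 (tensorRep X Y)) =
      leg23 (leg23 (leg13 X * leg23 Y)) := by
  simp only [conj_rebracket, conj_assoc_leg23, conj_map_leg23, conj_assoc_tensorRep]

section Group

variable {G : Type*} [Group G]

theorem braiding_intertwines {v₁₂ v₁₄ v₃₄ w₁₃ u₂₃ z₂₄ : G}
    (hcompat : u₂₃ * w₁₃ * v₁₂ = v₁₂ * w₁₃ * u₂₃) (hleft : v₃₄ * w₁₃ = w₁₃ * v₁₄ * v₃₄)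
    (hz : z₂₄ = v₃₄ * u₂₃⁻¹ * v₃₄⁻¹ * u₂₃) (hvv : Commute v₁₂ v₃₄) (hvu : Commute v₁₄ u₂₃)
    (hwz : Commute w₁₃ z₂₄) : v₁₄ * v₁₂ * z₂₄ = z₂₄ * v₁₂ * v₁₄ := by
  have hwvu : w₁₃ * v₁₂ * u₂₃⁻¹ = u₂₃⁻¹ * v₁₂ * w₁₃ := by
    rw [mul_inv_eq_iff_eq_mul, mul_assoc _ v₁₂, mul_assoc, ← hcompat]
    group
  refine mul_left_cancel (a := w₁₃) ?_
  calc w₁₃ * (v₁₄ * v₁₂ * z₂₄)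
      = (w₁₃ * v₁₄ * v₃₄) * (v₃₄⁻¹ * v₁₂) * z₂₄ := by group
    _ = v₃₄ * w₁₃ * v₁₂ * v₃₄⁻¹ * z₂₄ := by rw [← hleft, ← hvv.inv_right.eq]; group
    _ = v₃₄ * (w₁₃ * v₁₂ * u₂₃⁻¹) * v₃₄⁻¹ * u₂₃ := by rw [hz]; group
    _ = v₃₄ * u₂₃⁻¹ * (v₁₂ * v₃₄⁻¹) * (v₃₄ * w₁₃) * v₃₄⁻¹ * u₂₃ := by rw [hwvu]; group
    _ = v₃₄ * u₂₃⁻¹ * v₃₄⁻¹ * v₁₂ * w₁₃ * (v₁₄ * u₂₃) := by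
      rw [hleft, hvv.inv_right.eq]; group
    _ = v₃₄ * u₂₃⁻¹ * v₃₄⁻¹ * (v₁₂ * w₁₃ * u₂₃) * v₁₄ := by rw [hvu.eq]; group
    _ = (v₃₄ * u₂₃⁻¹ * v₃₄⁻¹ * u₂₃ * w₁₃) * v₁₂ * v₁₄ := by rw [← hcompat]; group
    _ = w₁₃ * (z₂₄ * v₁₂ * v₁₄) := by rw [← hz, ← hwz.eq]; group

theorem semiconjBy_inv_mul_mul (v f : G) : SemiconjBy v (v⁻¹ * f * v) f := by
  rw [SemiconjBy]
  group

theorem semiconjBy_braided_conj {v₂₃ v₂₅ v₄₅ f₁₅ u₃₄ w₂₄ z₃₅ : G}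
    (hleft : v₄₅ * w₂₄ = w₂₄ * v₂₅ * v₄₅) (hz : z₃₅ = v₄₅ * u₃₄⁻¹ * v₄₅⁻¹ * u₃₄)
    (hvz : v₂₅ * v₂₃ * z₃₅ = z₃₅ * v₂₃ * v₂₅) (hvu : Commute v₂₅ u₃₄)
    (hfv : Commute f₁₅ v₂₃) (hfu : Commute f₁₅ u₃₄) (hfw : Commute f₁₅ w₂₄) :
    SemiconjBy (v₂₅ * v₂₃ * v₄₅) ((w₂₄ * u₃₄)⁻¹ * (v₄₅⁻¹ * f₁₅ * v₄₅) * (w₂₄ * u₃₄))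
      (z₃₅ * f₁₅ * z₃₅⁻¹) := by
  have hfactor : v₂₅ * v₂₃ * v₄₅ =
      z₃₅ * (v₂₃ * u₃₄⁻¹ * w₂₄⁻¹) * (v₄₅ * (w₂₄ * u₃₄)) := by
    symm
    calc z₃₅ * (v₂₃ * u₃₄⁻¹ * w₂₄⁻¹) * (v₄₅ * (w₂₄ * u₃₄))
        = z₃₅ * v₂₃ * u₃₄⁻¹ * w₂₄⁻¹ * (v₄₅ * w₂₄) * u₃₄ := by group
      _ = z₃₅ * v₂₃ * (u₃₄⁻¹ * v₂₅) * v₄₅ * u₃₄ := by rw [hleft]; group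
      _ = v₂₅ * v₂₃ * z₃₅ * u₃₄⁻¹ * v₄₅ * u₃₄ := by rw [← hvu.inv_right.eq, hvz]; group
      _ = v₂₅ * v₂₃ * v₄₅ := by rw [hz]; group
  have hf : Commute (v₂₃ * u₃₄⁻¹ * w₂₄⁻¹) f₁₅ :=
    (hfv.symm.mul_left hfu.symm.inv_left).mul_left hfw.symm.inv_left
  have hout : SemiconjBy (z₃₅ * (v₂₃ * u₃₄⁻¹ * w₂₄⁻¹)) f₁₅ (z₃₅ * f₁₅ * z₃₅⁻¹) :=
    SemiconjBy.mul_left (SemiconjBy.conj_mk z₃₅ f₁₅) hf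
  rw [hfactor]
  refine hout.mul_left ?_
  simpa only [mul_inv_rev, mul_assoc] using semiconjBy_inv_mul_mul (v₄₅ * (w₂₄ * u₃₄)) f₁₅

theorem commute_conj_of_compatible {w₁₅ w₃₅ u₂₅ u₄₅ v₃₄ f₂₄ : G}
    (hcompat : u₄₅ * w₃₅ * v₃₄ = v₃₄ * w₃₅ * u₄₅) (hright : u₂₅ * u₄₅ * f₂₄ = f₂₄ * u₂₅ * u₄₅)
    (hwv : Commute w₁₅ v₃₄) (huv : Commute u₂₅ v₃₄) (hwf : Commute w₁₅ f₂₄)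
    (hfw : Commute f₂₄ w₃₅) :
    Commute (v₃₄⁻¹ * f₂₄ * v₃₄) (w₁₅ * u₂₅ * (w₃₅ * u₄₅)) := by
  have hv : SemiconjBy v₃₄ (w₁₅ * u₂₅ * (w₃₅ * u₄₅)) (w₁₅ * u₂₅ * (u₄₅ * w₃₅)) :=
    SemiconjBy.mul_right (hwv.symm.mul_right huv.symm)
      (by rw [SemiconjBy, ← mul_assoc, hcompat])
  have hu : Commute f₂₄ (u₂₅ * u₄₅) := by rw [Commute, SemiconjBy, hright, mul_assoc]
  have hf : Commute f₂₄ (w₁₅ * u₂₅ * (u₄₅ * w₃₅)) := by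
    simpa only [mul_assoc] using (hwf.symm.mul_right hu).mul_right hfw
  exact (hv.inv_symm_left.mul_left hf).mul_left hv

end Group

theorem leg13_eq_conj_leg12 (T : UnitaryOp (A ⊗ᴴ B)) :
    (leg13 T : UnitaryOp (A ⊗ᴴ (B ⊗ᴴ B))) =
      leg23 (comm B B) * leg12 T * (leg23 (comm B B))⁻¹ := rfl

end HilbertTensor

section Semidirect

variable {H K L : Type*} [NormedAddCommGroup H] [InnerProductSpace ℂ H]
  [NormedAddCommGroup K] [InnerProductSpace ℂ K] [NormedAddCommGroup L] [InnerProductSpace ℂ L]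

theorem IsBraidingUnitary.intertwines {W : UnitaryOp (H ⊗ᴴ H)} {U : UnitaryOp (K ⊗ᴴ H)}
    {V : UnitaryOp (H ⊗ᴴ K)} {V' : UnitaryOp (H ⊗ᴴ L)} {Z : UnitaryOp (K ⊗ᴴ L)}
    (hZ : IsBraidingUnitary U V' Z)
    (hUV : (leg23 U * leg13 W * leg12 V : UnitaryOp (H ⊗ᴴ (K ⊗ᴴ H))) =
      leg12 V * leg13 W * leg23 U)
    (hV' : IsLeftRep W V') :
    (leg13 V' * leg12 V * leg23 Z : UnitaryOp (H ⊗ᴴ (K ⊗ᴴ L))) =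
      leg23 Z * leg12 V * leg13 V' := by
  rcases subsingleton_or_nontrivial H with _ | _
  · exact LinearIsometryEquiv.ext fun _ => Subsingleton.elim _ _
  apply leg124_injective (C := H)
  have hcompat := congrArg (leg123 (D := L)) hUV
  have hleft := congrArg (leg13 (B := K)) hV'
  have hz := congrArg (leg23 (A := H)) hZ
  simp only [map_mul, leg123_leg12, leg123_leg13, leg123_leg23, leg13_mul, leg13_leg23,
    leg23_mul, leg23_inv] at hcompat hleft hz
  simp only [map_mul, leg124_leg12, leg124_leg13, leg124_leg23]
  exact braiding_intertwines hcompat hleft hz (commute_leg12_leg34 V V')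
    (commute_leg14_leg23 V' U) (commute_leg13_leg24 W Z)

/-- The operator `V₂₃* F₁₃ V₂₃` on `L ⊗ H ⊗ L`. Acting on the last three legs of
`H ⊗ L ⊗ H ⊗ L`, it is the second factor of the semidirect product. -/
noncomputable def fibreUnitary (V : UnitaryOp (H ⊗ᴴ L)) (F : UnitaryOp (L ⊗ᴴ L)) :
    UnitaryOp (L ⊗ᴴ (H ⊗ᴴ L)) :=
  (leg23 V)⁻¹ * leg13 F * leg23 V

theorem bicharToBase_eq_tensorRep (W : UnitaryOp (H ⊗ᴴ H)) (U : UnitaryOp (L ⊗ᴴ H)) :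
    bicharToBase W U = tensorRep W U := rfl

theorem semidirectProjection_eq_tensorRep (W : UnitaryOp (H ⊗ᴴ H)) (U : UnitaryOp (L ⊗ᴴ H)) :
    semidirectProjection W U = tensorRep (leg12 W) (leg12 U) :=
  leg12_tensorRep W U

theorem semidirectUnitary_eq_mul (W : UnitaryOp (H ⊗ᴴ H)) (U : UnitaryOp (L ⊗ᴴ H))
    (V : UnitaryOp (H ⊗ᴴ L)) (F : UnitaryOp (L ⊗ᴴ L)) :
    semidirectUnitary W U V F = semidirectProjection W U * tensorRep 1 (fibreUnitary V F) := by
  rw [tensorRep, leg13_one, one_mul]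
  rfl

theorem semidirectUnitary_eq_tensorRep (W : UnitaryOp (H ⊗ᴴ H)) (U : UnitaryOp (L ⊗ᴴ H))
    (V : UnitaryOp (H ⊗ᴴ L)) (F : UnitaryOp (L ⊗ᴴ L)) :
    semidirectUnitary W U V F = tensorRep (leg12 W) (leg12 U * fibreUnitary V F) := by
  rw [semidirectUnitary_eq_mul, semidirectProjection_eq_tensorRep, tensorRep_mul_right]

theorem IsRightRep.leg12_semidirectUnitary {W : UnitaryOp (H ⊗ᴴ H)} {X : UnitaryOp (K ⊗ᴴ H)}
    (h : IsRightRep W X) {U : UnitaryOp (L ⊗ᴴ H)} {V : UnitaryOp (H ⊗ᴴ L)}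
    {F : UnitaryOp (L ⊗ᴴ L)} : IsRightRep (semidirectUnitary W U V F) (leg12 X) := by
  rw [semidirectUnitary_eq_tensorRep]
  exact (ComposesTo.leg12_right h).leg12_tensorRep _

theorem IsRightRep.leg12_semidirectProjection {W : UnitaryOp (H ⊗ᴴ H)} {X : UnitaryOp (K ⊗ᴴ H)}
    (h : IsRightRep W X) {U : UnitaryOp (L ⊗ᴴ H)} :
    IsRightRep (semidirectProjection W U) (leg12 X) := by
  rw [semidirectProjection_eq_tensorRep]
  exact (ComposesTo.leg12_right h).leg12_tensorRep _

variable {W : UnitaryOp (H ⊗ᴴ H)} {U : UnitaryOp (L ⊗ᴴ H)} {V : UnitaryOp (H ⊗ᴴ L)}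
  {F : UnitaryOp (L ⊗ᴴ L)}

namespace IsBraidedMultiplicativeUnitary

theorem exists_braiding (h : IsBraidedMultiplicativeUnitary W U V F) :
    ∃ Z : UnitaryOp (L ⊗ᴴ L), IsBraidingUnitary U V Z ∧
      (leg23 F * leg12 F : UnitaryOp (L ⊗ᴴ (L ⊗ᴴ L))) =
        leg12 F * (leg23 Z * leg13 F * (leg23 Z)⁻¹) * leg23 F := by
  obtain ⟨Z, hZ, hF⟩ := h.braided_pentagon
  refine ⟨Z, hZ, hF.trans ?_⟩
  simp only [leg13_eq_conj_leg12, leg23_mul, leg23_inv, mul_inv_rev, mul_assoc]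

theorem fibre_pentagon (h : IsBraidedMultiplicativeUnitary W U V F) :
    (leg23 (leg23 (fibreUnitary V F)) * leg123 (fibreUnitary V F) :
      UnitaryOp (L ⊗ᴴ (H ⊗ᴴ (L ⊗ᴴ (H ⊗ᴴ L))))) =
      leg123 (fibreUnitary V F) *
        ((leg23 (leg13 (leg12 W) * leg23 (leg12 U)))⁻¹ * leg13 (leg13 (fibreUnitary V F)) *
          leg23 (leg13 (leg12 W) * leg23 (leg12 U))) *
        leg23 (leg23 (fibreUnitary V F)) := by
  obtain ⟨Z, hZ, hF⟩ := h.exists_braiding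
  have hleft := congrArg (leg23 (A := L)) (congrArg (leg13 (B := L)) h.leftRep)
  have hz := congrArg (leg23 (A := L)) (congrArg (leg23 (A := H)) hZ)
  have hvf := congrArg (leg23 (A := L)) (congrArg (leg124 (C := H)) h.left_invariant)
  have hvz := congrArg (leg23 (A := L))
    (congrArg (leg124 (C := H)) (hZ.intertwines h.compatible h.leftRep))
  have hpentagon := congrArg (leg13 (B := H)) (congrArg (leg124 (C := H)) hF)
  simp only [fibreUnitary, map_mul, map_inv, leg13_mul, leg13_inv, leg23_mul, leg23_inv,
    leg13_leg23, leg123_leg13, leg123_leg23, leg124_leg12, leg124_leg13, leg124_leg23]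
    at hleft hz hvf hvz hpentagon ⊢
  have hvv := leg23_commute (A := L) (commute_leg12_leg34 V V)
  have hvu := leg23_commute (A := L) (commute_leg14_leg23 V U)
  have hfv := commute_leg14_leg23 (leg13 F : UnitaryOp (L ⊗ᴴ (H ⊗ᴴ L))) V
  have hfu := leg13_commute (B := H) (commute_leg14_leg23 F U)
  have hfw := (commute_leg14_leg23 F W).map (leg124 (C := L))
  have hf₁₃v₂₅ := commute_leg13_leg24 F (leg13 V : UnitaryOp (H ⊗ᴴ (H ⊗ᴴ L)))
  have hf₁₃v₄₅ := leg13_commute (B := H) (commute_leg12_leg34 F V)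
  simp only [leg13_leg23, leg124_leg13, leg124_leg23] at hfu hfw hf₁₃v₄₅
  refine pentagon_of_semiconjBy ?_ ?_ (semiconjBy_braided_conj hleft hz hvz hvu hfv hfu hfw)
    hpentagon
  · rw [mul_assoc, hvv.eq, ← mul_assoc]
    exact SemiconjBy.mul_left (hf₁₃v₂₅.symm.mul_left hf₁₃v₄₅.symm) (semiconjBy_inv_mul_mul _ _)
  · exact SemiconjBy.mul_left (hvf.trans (mul_assoc _ _ _)) (semiconjBy_inv_mul_mul _ _)

theorem fibre_commute_bicharToBase (h : IsBraidedMultiplicativeUnitary W U V F) :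
    Commute (leg12 (tensorRep (1 : UnitaryOp (H ⊗ᴴ (H ⊗ᴴ L))) (fibreUnitary V F)))
      (leg13 (bicharToBase W U) * leg23 (bicharToBase W U)) := by
  have hcompat := congrArg (leg23 (A := H)) (congrArg (leg23 (A := L)) h.compatible)
  have hright := congrArg (leg23 (A := H)) (congrArg (leg13 (B := H)) h.right_invariant)
  have hvw := leg13_commute (B := L) (commute_leg14_leg23 W V)
  have hvu := leg23_commute (A := H) (commute_leg14_leg23 U V)
  have hwf := (commute_leg14_leg23 W F).map (leg124 (C := H))
  have hfw := leg23_commute (A := H) (commute_leg13_leg24 F W)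
  apply HilbertTensor.conj_injective rebracket
  simp only [bicharToBase_eq_tensorRep, HilbertTensor.conj_mul, conj_rebracket_leg12_tensorRep,
    conj_rebracket_leg13_tensorRep, conj_rebracket_leg23_tensorRep, fibreUnitary, map_mul,
    map_inv, map_one, leg13_mul, leg13_one, one_mul, leg23_mul, leg23_inv, leg13_leg23,
    leg123_leg13, leg123_leg23, leg124_leg13, leg124_leg23] at hcompat hright hvw hwf ⊢
  exact (commute_conj_of_compatible hcompat hright hvw hvu hwf hfw).eq

theorem tensorRep_one_fibreUnitary_pentagon (h : IsBraidedMultiplicativeUnitary W U V F) :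
    (leg23 (tensorRep 1 (fibreUnitary V F)) * leg12 (tensorRep 1 (fibreUnitary V F)) :
        UnitaryOp ((H ⊗ᴴ L) ⊗ᴴ ((H ⊗ᴴ L) ⊗ᴴ (H ⊗ᴴ L)))) =
      leg12 (tensorRep 1 (fibreUnitary V F)) *
        ((leg23 (semidirectProjection W U))⁻¹ * leg13 (tensorRep 1 (fibreUnitary V F)) *
          leg23 (semidirectProjection W U)) *
        leg23 (tensorRep 1 (fibreUnitary V F)) := by
  apply HilbertTensor.conj_injective rebracket
  simpa only [semidirectProjection_eq_tensorRep, HilbertTensor.conj_mul, HilbertTensor.conj_inv,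
    conj_rebracket_leg12_tensorRep, conj_rebracket_leg13_tensorRep,
    conj_rebracket_leg23_tensorRep, map_one, leg13_one, one_mul, leg23_mul, leg23_inv]
    using congrArg (leg23 (A := H)) h.fibre_pentagon

theorem isRightRep_bicharToBase (h : IsBraidedMultiplicativeUnitary W U V F) :
    IsRightRep W (bicharToBase W U) :=
  ComposesTo.tensorRep_left h.multiplicative h.rightRep

theorem isLeftRep_bicharToBase (h : IsBraidedMultiplicativeUnitary W U V F) :
    IsLeftRep (semidirectUnitary W U V F) (bicharToBase W U) := by
  have hP : ComposesTo (semidirectProjection W U) (bicharToBase W U) (bicharToBase W U) :=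
    ComposesTo.leg12_tensorRep h.isRightRep_bicharToBase U
  have hQ := h.fibre_commute_bicharToBase.eq
  rw [IsLeftRep, semidirectUnitary_eq_mul, leg12_mul, ← mul_assoc, hP]
  simp only [mul_assoc] at hQ ⊢
  rw [hQ]

theorem isComposite_semidirectProjection (h : IsBraidedMultiplicativeUnitary W U V F) :
    IsCompositeBicharacter (bicharToBase W U) (bicharFromBase W)
      (semidirectProjection W U) := by
  rcases subsingleton_or_nontrivial H with _ | _
  · exact fun _ => iff_of_true (LinearIsometryEquiv.ext fun _ => Subsingleton.elim _ _)
      (LinearIsometryEquiv.ext fun _ => Subsingleton.elim _ _)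
  · exact (ComposesTo.leg12_right h.isRightRep_bicharToBase).isComposite

theorem isMultiplicativeUnitary_semidirectUnitary (h : IsBraidedMultiplicativeUnitary W U V F) :
    IsMultiplicativeUnitary (semidirectUnitary W U V F) := by
  have hP : ComposesTo (semidirectUnitary W U V F) (semidirectProjection W U)
      (semidirectProjection W U) :=
    ComposesTo.leg12_right h.isLeftRep_bicharToBase
  rw [ComposesTo, semidirectUnitary_eq_mul, leg12_mul] at hP
  rw [IsMultiplicativeUnitary, semidirectUnitary_eq_mul, leg12_mul, leg13_mul, leg23_mul]
  exact pentagon_mul hP h.tensorRep_one_fibreUnitary_pentagon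
    (commute_leg23_tensorRep_one (bicharToBase W U) (fibreUnitary V F))

end IsBraidedMultiplicativeUnitary

end Semidirect

theorem mainTheorem8_general {H L : Type*}
    [NormedAddCommGroup H] [InnerProductSpace ℂ H]
    [NormedAddCommGroup L] [InnerProductSpace ℂ L]
    (W : UnitaryOp (H ⊗ᴴ H)) (U : UnitaryOp (L ⊗ᴴ H))
    (V : UnitaryOp (H ⊗ᴴ L)) (F : UnitaryOp (L ⊗ᴴ L))
    (hF : IsBraidedMultiplicativeUnitary W U V F)
    (WC P : UnitaryOp ((H ⊗ᴴ L) ⊗ᴴ (H ⊗ᴴ L)))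
    (hWC : WC = semidirectUnitary W U V F)
    (hP : P = semidirectProjection W U) :
    IsMultiplicativeUnitary WC ∧
    IsBicharacter WC W (bicharToBase W U) ∧
    IsBicharacter W WC (bicharFromBase W) ∧
    IsCompositeBicharacter (bicharToBase W U) (bicharFromBase W) P ∧
    (leg23 P * leg12 WC : UnitaryOp ((H ⊗ᴴ L) ⊗ᴴ ((H ⊗ᴴ L) ⊗ᴴ (H ⊗ᴴ L)))) =
      leg12 WC * leg13 P * leg23 P ∧
    (leg23 WC * leg12 P : UnitaryOp ((H ⊗ᴴ L) ⊗ᴴ ((H ⊗ᴴ L) ⊗ᴴ (H ⊗ᴴ L)))) =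
      leg12 P * leg13 P * leg23 WC ∧
    (leg23 P * leg12 P : UnitaryOp ((H ⊗ᴴ L) ⊗ᴴ ((H ⊗ᴴ L) ⊗ᴴ (H ⊗ᴴ L)))) =
      leg12 P * leg13 P * leg23 P := by
  subst hWC hP
  have hb := hF.isRightRep_bicharToBase
  have hbC := hF.isLeftRep_bicharToBase
  exact ⟨hF.isMultiplicativeUnitary_semidirectUnitary, ⟨hb, hbC⟩,
    ⟨IsRightRep.leg12_semidirectUnitary hF.multiplicative,
      ComposesTo.leg12_right hF.multiplicative⟩,
    hF.isComposite_semidirectProjection, ComposesTo.leg12_right hbC, hb.leg12_semidirectUnitary,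
    hb.leg12_semidirectProjection⟩

theorem mainTheorem8 {H L : Type*}
    [NormedAddCommGroup H] [InnerProductSpace ℂ H] [CompleteSpace H]
    [NormedAddCommGroup L] [InnerProductSpace ℂ L] [CompleteSpace L]
    (W : UnitaryOp (H ⊗ᴴ H)) (U : UnitaryOp (L ⊗ᴴ H))
    (V : UnitaryOp (H ⊗ᴴ L)) (F : UnitaryOp (L ⊗ᴴ L))
    (hF : IsBraidedMultiplicativeUnitary W U V F)
    (WC P : UnitaryOp ((H ⊗ᴴ L) ⊗ᴴ (H ⊗ᴴ L)))
    (hWC : WC = semidirectUnitary W U V F)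
    (hP : P = semidirectProjection W U) :
    IsMultiplicativeUnitary WC ∧
    IsBicharacter WC W (bicharToBase W U) ∧
    IsBicharacter W WC (bicharFromBase W) ∧
    IsCompositeBicharacter (bicharToBase W U) (bicharFromBase W) P ∧
    (leg23 P * leg12 WC : UnitaryOp ((H ⊗ᴴ L) ⊗ᴴ ((H ⊗ᴴ L) ⊗ᴴ (H ⊗ᴴ L)))) =
      leg12 WC * leg13 P * leg23 P ∧
    (leg23 WC * leg12 P : UnitaryOp ((H ⊗ᴴ L) ⊗ᴴ ((H ⊗ᴴ L) ⊗ᴴ (H ⊗ᴴ L)))) =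
      leg12 P * leg13 P * leg23 WC ∧
    (leg23 P * leg12 P : UnitaryOp ((H ⊗ᴴ L) ⊗ᴴ ((H ⊗ᴴ L) ⊗ᴴ (H ⊗ᴴ L)))) =
      leg12 P * leg13 P * leg23 P := by
  exact mainTheorem8_general W U V F hF WC P hWC hP
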